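/- **Setting.** Let $G$ be a finite set of good types with integer supplies $s_j$ ($j\in G$), let $k\in\mathbb N$, and let $\mathcal B=\{B\in\mathbb Z_{\ge 0}^{G}: 1\le\sum_j B_j\le k\}$ be the set of bundles. There is a finite set $\Theta$ of agent types; an agent of type $\theta$ has valuation $u_\theta:\mathcal B\to\mathbb R$. Let $0<\delta_w<1$, $\delta_\epsilon>0$ with $2\delta_\epsilon<s_j$ for all $j$, and let $\mathrm{tol}>0$. The random draw consists of weights $w_\theta(B)$, uniform on $[1-\delta_w,1+\delta_w]$, and supply reductions $\epsilon_j$, uniform on $[\delta_\epsilon,2\delta_\epsilon]$, all independent; agents (reported to be) of the same type have the same weights. **The POPT mechanism.** Given a set $N$ of $n$ agents with reported types $(\beta_i)_{i\in N}$ and a draw, put $v_i(B)=w_{\beta_i}(B)u_{\beta_i}(B)$ and consider the linear program (LIP) $$\max_{x\ge 0}\ \sum_{i,B}v_i(B)x_i(B)\quad\text{s.t.}\quad \sum_B x_i(B)\le 1\ (i\in N),\qquad \sum_{i,B}B_jx_i(B)\le s_j-\epsilon_j\ (j\in G).$$ 1. Take an optimal solution $x^*$ of (LIP), and prices $p$ such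 that $(\alpha,p)$ is, for some $\alpha$, an optimal solution of the dual program: $\min_{\alpha,p\ge 0}\sum_i\alpha_i+\sum_j(s_j-\epsilon_j)p_j$ subject to $\alpha_i\ge v_i(B)-\sum_jB_jp_j$ for all $i,B$. The price of a bundle $B$ is $p(B)=\sum_jB_jp_j$. 2. *Iterative rounding* $\mathrm{IR}(z;c)$ of a point $z$ with reward vector $c$: let $N_0=\{i:\sum_Bz_i(B)=1\}$ and start with all supply constraints (with supplies $s_j$) active. While the current point $z$ is not integral, replace it by an extreme point $z'$ that maximizes $\langle c,x\rangle$ over all $x\ge0$ such that $x_i(B)=z_i(B)$ for every entry of $z$ that is not strictly between $0$ and $1$, $\sum_Bx_i(B)=1$ for $i\in N_0$, $\sum_Bx_i(B)\le1$ for $i\notin N_0$, and $x$ satisfies the active supply constraints. If no entry that was fractional in $z$ has become integral in $z'$, then keep active only those active $j$ for which $\sum_{(i,B)\in R}B_j>\lceil s_j-\sum_{(i,B)\notin R}B_jz_i(B)\rceil+k-1$, where $R$ is the set of fractional entries of $z$. 3. *Lottery construction*: start with $F=\{\mathrm{IR}(x^*;v),\mathrm{IR}(x^*;-v)\}$. Let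 $y$ be the point of $\mathrm{conv}F$ nearest to $x^*$ in Euclidean norm. If $\|y-x^*\|<\mathrm{tol}$, stop. Otherwise choose a minimal $F'\subseteq F$ with $y$ in the relative interior of $\mathrm{conv}F'$, put $z=x^*+\delta\,\frac{x^*-y}{\|x^*-y\|}$, where $0<\delta\le\delta_z:=\delta_\epsilon/\sqrt{n\sum_BB_j^2}$ ($\delta_z$ does not depend on $j$) is such that $z\ge0$, $\sum_B z_i(B)\le1$ for all $i$ and $\sum_{i,B}B_jz_i(B)\le s_j$ for all $j$, replace $F$ by $F'\cup\{\mathrm{IR}(z;x^*-y)\}$, and repeat. When the construction stops, the integral allocation $\overline x$ is drawn from a probability distribution on $F$ with mean $y$. Any rule may be used for the choices left open here (which optimal solutions are taken, which $F'$, $\delta$, and distribution), as long as the prices and the lottery probabilities depend measurably on the draw. **Theorem.** Let the acceptable error $\epsilon_u>0$ satisfy $2\delta_w\,u_\theta(B)\le\epsilon_u$ for all $\theta\in\Theta$, $B\in\mathcal B$. Then every such mechanism is asymptotically strategy-proof: for every $\varepsilon_0>0$ there is $N_0\in\mathbb N$ such that for every finite population of agents with true types $(\beta_i)$ in which every type $\theta\in\Theta$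 has $n_\theta>N_0$ agents, every agent $i$ and every type $\zeta\in\Theta$, $$\mathbb E\Big[\sum_{B\in\mathcal B}\big(u_{\beta_i}(B)-\overline p(B)\big)\overline x_i(B)\Big]\ \ge\ \mathbb E\Big[\sum_{B\in\mathcal B}\big(u_{\beta_i}(B)-\tilde p(B)\big)\tilde x_i(B)\Big]-\epsilon_u-\varepsilon_0,$$ where $(\overline x,\overline p)$ is the result when all agents report truthfully, $(\tilde x,\tilde p)$ is the result when agent $i$ reports $\zeta$ and all others report truthfully, and the expectations, over the draw and the lottery, exist. -/

import Mathlib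

open MeasureTheory

namespace POPT

/-- The nonempty `k`-bundles: vectors of nonnegative integers indexed by the good types `G`,
of size (number of goods, with multiplicity) between `1` and `k`. -/
def Bundle (G : Type*) [Fintype G] (k : ℕ) : Type _ :=
  {B : G → ℕ // 1 ≤ ∑ j, B j ∧ ∑ j, B j ≤ k}

theorem Bundle.finite (G : Type*) [Fintype G] (k : ℕ) : Finite (Bundle G k) := by
  have hle : ∀ (B : Bundle G k) (j : G), B.1 j < k + 1 := fun B j =>
    Nat.lt_succ_of_le
      ((Finset.single_le_sum (f := B.1) (fun _ _ => Nat.zero_le _) (Finset.mem_univ j)).trans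
        B.2.2)
  refine Finite.of_injective
    (fun (B : Bundle G k) (j : G) => (⟨B.1 j, hle B j⟩ : Fin (k + 1))) ?_
  intro B C h
  apply Subtype.ext
  funext j
  exact congrArg Fin.val (congrFun h j)

noncomputable instance (G : Type*) [Fintype G] (k : ℕ) : Fintype (Bundle G k) :=
  @Fintype.ofFinite _ (Bundle.finite G k)

noncomputable instance (G : Type*) [Fintype G] (k : ℕ) : DecidableEq (Bundle G k) :=
  Classical.decEq _

/-- The data of an auction with agent types `Θ` and good types `G`: the bundle size bound `k`,
the integral supplies `s`, the valuation `u θ` of each type, the half-width `δw` of the random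
weights, the scale `δε` of the random supply reductions, and the tolerance `tol` of the lottery
construction. -/
structure Auction (Θ G : Type*) [Fintype G] where
  k : ℕ
  s : G → ℕ
  u : Θ → Bundle G k → ℝ
  δw : ℝ
  δε : ℝ
  tol : ℝ

section LinearPrograms

variable {N G : Type*} [Fintype N] [Fintype G] {k : ℕ}

/-- `∑ i, ∑ B, c i B * x i B`. -/
noncomputable def value (c x : N → Bundle G k → ℝ) : ℝ :=
  ∑ i, ∑ B, c i B * x i B

/-- The amount of good `j` used by a (fractional) allocation. -/
noncomputable def usage (x : N → Bundle G k → ℝ) (j : G) : ℝ :=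
  ∑ i, ∑ B, (B.1 j : ℝ) * x i B

/-- Nonnegative, (Demand), and (Supply) with supply vector `σ`. -/
def Feasible (σ : G → ℝ) (x : N → Bundle G k → ℝ) : Prop :=
  (∀ i B, 0 ≤ x i B) ∧ (∀ i, ∑ B, x i B ≤ 1) ∧ ∀ j, usage x j ≤ σ j

/-- `x` is an optimal solution of the allocation linear program with objective coefficients `v`
and supply vector `σ`. -/
def IsPrimalOptimal (v : N → Bundle G k → ℝ) (σ : G → ℝ) (x : N → Bundle G k → ℝ) : Prop :=
  Feasible σ x ∧ ∀ x', Feasible σ x' → value v x' ≤ value v x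

/-- The linear price of a bundle. -/
noncomputable def price (p : G → ℝ) (B : Bundle G k) : ℝ :=
  ∑ j, (B.1 j : ℝ) * p j

/-- Feasibility for the dual linear program. -/
def DualFeasible (v : N → Bundle G k → ℝ) (α : N → ℝ) (p : G → ℝ) : Prop :=
  (∀ i, 0 ≤ α i) ∧ (∀ j, 0 ≤ p j) ∧ ∀ i B, v i B - price p B ≤ α i

/-- The objective of the dual linear program. -/
noncomputable def dualValue (σ : G → ℝ) (α : N → ℝ) (p : G → ℝ) : ℝ :=
  ∑ i, α i + ∑ j, σ j * p j

/-- `(α, p)` is an optimal solution of the dual linear program. -/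
def IsDualOptimal (v : N → Bundle G k → ℝ) (σ : G → ℝ) (α : N → ℝ) (p : G → ℝ) : Prop :=
  DualFeasible v α p ∧ ∀ α' p', DualFeasible v α' p' → dualValue σ α p ≤ dualValue σ α' p'

end LinearPrograms

section IterativeRounding

variable {N G : Type*} [Fintype N] [Fintype G] {k : ℕ}

/-- All entries are `0` or `1`. -/
def IsIntegral (x : N → Bundle G k → ℝ) : Prop :=
  ∀ i B, x i B = 0 ∨ x i B = 1

/-- The entry of `z` for agent `i` and bundle `B` is strictly fractional. -/
def Fractional (z : N → Bundle G k → ℝ) (i : N) (B : Bundle G k) : Prop :=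
  0 < z i B ∧ z i B < 1

/-- The feasible region of the updated linear program in a round that starts at `z`: the entries
of `z` that are not fractional are frozen, the demand constraints of the agents in `N₀` are
equalities, and only the supply constraints of the goods in `A` are kept. -/
def ulipRegion (σ : G → ℝ) (N₀ : Set N) (A : Set G) (z : N → Bundle G k → ℝ) :
    Set (N → Bundle G k → ℝ) :=
  {x | (∀ i B, 0 ≤ x i B) ∧
    (∀ i B, ¬ Fractional z i B → x i B = z i B) ∧
    (∀ i ∈ N₀, ∑ B, x i B = 1) ∧
    (∀ i, i ∉ N₀ → ∑ B, x i B ≤ 1) ∧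
    ∀ j ∈ A, usage x j ≤ σ j}

open Classical in
/-- The supply constraint of good `j` stays active after a round that started at `z` and fixed
no new entry: the fractional bundles together contain more than `⌈s'⌉ + k - 1` units of good `j`,
where `s'` is the supply left over by the frozen entries. -/
def StaysActive (σ : G → ℝ) (z : N → Bundle G k → ℝ) (j : G) : Prop :=
  ⌈σ j - ∑ i, ∑ B : Bundle G k,
      (if Fractional z i B then 0 else (B.1 j : ℝ) * z i B)⌉ + (k : ℤ) - 1
    < ∑ i, ∑ B : Bundle G k, (if Fractional z i B then (B.1 j : ℤ) else 0)

/-- One round of iterative rounding with reward vector `c`; the state is the current point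
together with the set of goods whose supply constraint is active. -/
def IRStep (σ : G → ℝ) (c : N → Bundle G k → ℝ) (N₀ : Set N)
    (st st' : (N → Bundle G k → ℝ) × Set G) : Prop :=
  ¬ IsIntegral st.1 ∧
  st'.1 ∈ Set.extremePoints ℝ (ulipRegion σ N₀ st.2 st.1) ∧
  (∀ x ∈ ulipRegion σ N₀ st.2 st.1, value c x ≤ value c st'.1) ∧
  ((∃ i B, Fractional st.1 i B ∧ ¬ Fractional st'.1 i B) → st'.2 = st.2) ∧
  ((¬ ∃ i B, Fractional st.1 i B ∧ ¬ Fractional st'.1 i B) →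
    st'.2 = {j ∈ st.2 | StaysActive σ st.1 j})

/-- `x` is a possible output of iterative rounding on the input `z`, with reward vector `c`
(the linear programs may have several optimal extreme points). -/
def IsIR (σ : G → ℝ) (z c x : N → Bundle G k → ℝ) : Prop :=
  ∃ A : Set G,
    Relation.ReflTransGen (IRStep σ c {i | ∑ B, z i B = 1}) (z, Set.univ) (x, A) ∧ IsIntegral x

end IterativeRounding

section LotteryConstruction

variable {N G : Type*} [Fintype N] [Fintype G] {k : ℕ}

/-- Euclidean distance. -/
noncomputable def l2dist (x y : N → Bundle G k → ℝ) : ℝ :=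
  Real.sqrt (∑ i, ∑ B, (x i B - y i B) ^ 2)

/-- `y` is the point of the convex hull of `F` nearest to `x`. -/
def IsNearest (F : Set (N → Bundle G k → ℝ)) (x y : N → Bundle G k → ℝ) : Prop :=
  y ∈ convexHull ℝ F ∧ ∀ y' ∈ convexHull ℝ F, l2dist x y ≤ l2dist x y'

/-- The step length `δ_z`; its value does not depend on the good `j`. -/
noncomputable def stepLength (N : Type*) [Fintype N] {G : Type*} [Fintype G] (k : ℕ) (δε : ℝ)
    (j : G) : ℝ :=
  δε / Real.sqrt ((Fintype.card N : ℝ) * ∑ B : Bundle G k, (B.1 j : ℝ) ^ 2)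

/-- One round of the lottery construction for `x`, on the current set of integral points.  The
step from `x` away from the nearest point `y` has length `δ_z`, or less where this is needed to
make the new point `z` nonnegative and feasible for (Demand) and (Supply). -/
def LotteryStep (σ : G → ℝ) (δε tol : ℝ) (x : N → Bundle G k → ℝ)
    (F F₂ : Set (N → Bundle G k → ℝ)) : Prop :=
  ∃ (y : N → Bundle G k → ℝ) (F' : Set (N → Bundle G k → ℝ)) (δ : ℝ)
    (z zbar : N → Bundle G k → ℝ),
    IsNearest F x y ∧ tol ≤ l2dist x y ∧
    Minimal (fun E => E ⊆ F ∧ y ∈ intrinsicInterior ℝ (convexHull ℝ E)) F' ∧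
    0 < δ ∧ (∀ j : G, δ ≤ stepLength N k δε j) ∧
    z = x + (δ / l2dist x y) • (x - y) ∧ Feasible σ z ∧
    IsIR σ z (x - y) zbar ∧
    F₂ = insert zbar F'

/-- `F` can be reached by the lottery construction for `x` (with objective coefficients `v`). -/
def IsLotterySet (v : N → Bundle G k → ℝ) (σ : G → ℝ) (δε tol : ℝ)
    (x : N → Bundle G k → ℝ) (F : Set (N → Bundle G k → ℝ)) : Prop :=
  ∃ x' x'', IsIR σ x v x' ∧ IsIR σ x (-v) x'' ∧
    Relation.ReflTransGen (LotteryStep σ δε tol x) {x', x''} F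

/-- The `0`-`1` allocation given by a Boolean matrix. -/
def ofBool (a : N → Bundle G k → Bool) : N → Bundle G k → ℝ :=
  fun i B => if a i B then 1 else 0

/-- `lam` is a possible final lottery of the lottery construction for `x`: the construction has
stopped at a set `F` whose convex hull comes within `tol` of `x`, and `lam` is a probability
distribution on `F` whose mean is the point of the convex hull nearest to `x`. -/
def IsLottery [DecidableEq N] (v : N → Bundle G k → ℝ) (σ : G → ℝ) (δε tol : ℝ)
    (x : N → Bundle G k → ℝ) (lam : (N → Bundle G k → Bool) → ℝ) : Prop :=
  ∃ (F : Set (N → Bundle G k → ℝ)) (y : N → Bundle G k → ℝ),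
    IsLotterySet v σ δε tol x F ∧ IsNearest F x y ∧ l2dist x y < tol ∧
    (∀ a, 0 ≤ lam a) ∧ (∀ a, lam a ≠ 0 → ofBool a ∈ F) ∧
    ∑ a, lam a = 1 ∧ ∑ a, lam a • ofBool a = y

end LotteryConstruction

section Mechanisms

variable {Θ G : Type*} [Fintype G]

/-- The random draw of the mechanism: a weight for every type and bundle (so that agents of the
same type have the same weights), and a supply reduction for every good. -/
abbrev Draw (Θ : Type*) {G : Type*} [Fintype G] (k : ℕ) : Type _ :=
  (Θ × Bundle G k → ℝ) × (G → ℝ)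

/-- The uniform distribution on `[a, b]`. -/
noncomputable def unif (a b : ℝ) : Measure ℝ :=
  ProbabilityTheory.cond volume (Set.Icc a b)

/-- The law of the draw: all weights are uniform on `[1 - δw, 1 + δw]`, all supply reductions are
uniform on `[δε, 2 δε]`, and all of them are independent. -/
noncomputable def drawLaw [Fintype Θ] (P : Auction Θ G) : Measure (Draw Θ (G := G) P.k) :=
  (Measure.pi fun _ : Θ × Bundle G P.k => unif (1 - P.δw) (1 + P.δw)).prod
    (Measure.pi fun _ : G => unif P.δε (2 * P.δε))

/-- The result of a mechanism with `n` agents for one draw: prices of the goods and the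
probabilities of the integral allocations in the lottery. -/
structure Outcome (G : Type*) [Fintype G] (k n : ℕ) where
  prices : G → ℝ
  lottery : (Fin n → Bundle G k → Bool) → ℝ

/-- A mechanism turns the reported types of any number of agents, and the draw, into a result. -/
abbrev Mechanism (Θ : Type*) (G : Type*) [Fintype G] (k : ℕ) : Type _ :=
  ∀ n : ℕ, (Fin n → Θ) → Draw Θ (G := G) k → Outcome G k n

/-- The objective coefficients `w_i(B) u_i(B)` for the reported types `β`. -/
def weighted (P : Auction Θ G) {n : ℕ} (β : Fin n → Θ) (d : Draw Θ (G := G) P.k) :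
    Fin n → Bundle G P.k → ℝ :=
  fun i B => d.1 (β i, B) * P.u (β i) B

/-- The reduced supplies `s_j - ε_j`. -/
def reducedSupply (P : Auction Θ G) (d : Draw Θ (G := G) P.k) : G → ℝ :=
  fun j => (P.s j : ℝ) - d.2 j

/-- `o` is a possible result of the POPT mechanism for the reports `β` and the draw `d`: the
lottery comes from the lottery construction for some optimal solution of the linear program, and
the prices are the supply part of some optimal solution of its dual. -/
def IsPOPTOutcome (P : Auction Θ G) {n : ℕ} (β : Fin n → Θ) (d : Draw Θ (G := G) P.k)
    (o : Outcome G P.k n) : Prop :=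
  (∃ x, IsPrimalOptimal (weighted P β d) (reducedSupply P d) x ∧
    IsLottery (weighted P β d) (fun j => (P.s j : ℝ)) P.δε P.tol x o.lottery) ∧
  ∃ α, IsDualOptimal (weighted P β d) (reducedSupply P d) α o.prices

/-- `M` is a POPT mechanism: for almost every draw its result is one of the possible results of
POPT, and it depends measurably on the draw. -/
def IsPOPT [Fintype Θ] (P : Auction Θ G) (M : Mechanism Θ G P.k) : Prop :=
  ∀ (n : ℕ) (β : Fin n → Θ),
    (∀ᵐ d ∂drawLaw P, IsPOPTOutcome P β d (M n β d)) ∧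
    (∀ j, AEMeasurable (fun d => (M n β d).prices j) (drawLaw P)) ∧
    ∀ a, AEMeasurable (fun d => (M n β d).lottery a) (drawLaw P)

/-- The expectation over the lottery of the payoff `∑ B, (u_θ(B) - p(B)) x_i(B)` of agent `i`,
whose true type is `θ`. -/
noncomputable def payoff (P : Auction Θ G) {n : ℕ} (θ : Θ) (i : Fin n) (o : Outcome G P.k n) : ℝ :=
  ∑ a, o.lottery a * ∑ B, (P.u θ B - price o.prices B) * ofBool a i B

/-- Asymptotic strategy-proofness with acceptable error `εu`.  The expectation is over the draw
and the lottery; agent `i` evaluates both outcomes with its true type `β i`. -/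
def AsymptoticallyStrategyProof [Fintype Θ] [DecidableEq Θ] (P : Auction Θ G)
    (M : Mechanism Θ G P.k) (εu : ℝ) : Prop :=
  ∀ ε₀ : ℝ, 0 < ε₀ → ∃ N₀ : ℕ, ∀ (n : ℕ) (β : Fin n → Θ),
    (∀ θ, N₀ < Fintype.card {i // β i = θ}) →
    ∀ (i : Fin n) (ζ : Θ),
      Integrable (fun d => payoff P (β i) i (M n β d)) (drawLaw P) ∧
      Integrable (fun d => payoff P (β i) i (M n (Function.update β i ζ) d)) (drawLaw P) ∧
      ∫ d, payoff P (β i) i (M n (Function.update β i ζ) d) ∂drawLaw P - εu - ε₀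
        ≤ ∫ d, payoff P (β i) i (M n β d) ∂drawLaw P

end Mechanisms

end POPT

/-
The supply is fixed, so once the agents reporting a type outnumber the goods, dual optimality forces
the price of every bundle up to the weighted value `w u` of that type.  Hence an agent of this type
gains at most `u - w u ≤ δ_w u ≤ ε_u / 2` whatever it reports, as long as the others of its type
still outnumber the goods.  Conversely, the lottery only gives an agent bundles in the support of
the linear programming solution, because rounding never raises a zero entry; by complementary
slackness such bundles cost at most `w u ≤ u + ε_u / 2`, so that a truthful agent loses at most
`ε_u / 2`.
-/

namespace POPT

section ConvexDuality

theorem nonpos_of_forall_mul_le {a u : ℝ} (h : ∀ t : ℝ, 0 ≤ t → t * a ≤ u) : a ≤ 0 := by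
  by_contra! ha
  have hu := h ((|u| + 1) / a) (by positivity)
  rw [div_mul_cancel₀ _ ha.ne'] at hu
  linarith [le_abs_self u]

theorem sum_smul_mem_of_sum_le_one {ι E : Type*} [Fintype ι] [AddCommGroup E] [Module ℝ E]
    {K : Set E} (hK : Convex ℝ K) (hzero : 0 ∈ K) {w : ι → ℝ} {z : ι → E} (hw : ∀ l, 0 ≤ w l)
    (hsum : ∑ l, w l ≤ 1) (hz : ∀ l, w l ≠ 0 → z l ∈ K) : ∑ l, w l • z l ∈ K := by
  have hmem := hK.finsum_mem (w := fun o : Option ι => o.elim (1 - ∑ l, w l) w)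
    (z := fun o => o.elim 0 z) (Option.forall.2 ⟨sub_nonneg.2 hsum, hw⟩)
    (by simp [finsum_eq_sum_of_fintype, Fintype.sum_option])
    (Option.forall.2 ⟨fun _ => hzero, hz⟩)
  simpa [finsum_eq_sum_of_fintype, Fintype.sum_option] using hmem

variable {E ι κ : Type*} [AddCommMonoid E] [Module ℝ E] {K : Set E}

theorem convex_setOf_exists_le {h : E → ι → ℝ} (hh : ConvexOn ℝ K h) :
    Convex ℝ {t | ∃ x ∈ K, h x ≤ t} := by
  have himage : {t | ∃ x ∈ K, h x ≤ t} =
      LinearMap.snd ℝ E (ι → ℝ) '' {p | p.1 ∈ K ∧ h p.1 ≤ p.2} := by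
    ext t
    simp
  exact himage ▸ hh.convex_epigraph.linear_image _

variable [Fintype ι] [Fintype κ]

/-- The Fan–Glicksberg–Hoffman theorem of the alternative. -/
theorem exists_weights_of_not_exists_forall_neg {h : E → ι → ℝ} (hh : ConvexOn ℝ K h)
    (hne : K.Nonempty) (hneg : ¬ ∃ x ∈ K, ∀ l, h x l < 0) :
    ∃ w : ι → ℝ, 0 ≤ w ∧ w ≠ 0 ∧ ∀ x ∈ K, 0 ≤ ∑ l, w l * h x l := by
  classical
  have hint : interior (Set.Iic (0 : ι → ℝ)) = {t | ∀ l, t l < 0} := by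
    rw [← Set.pi_univ_Iic, interior_pi_set Set.finite_univ]
    ext t
    simp
  have hdisj : Disjoint (interior (Set.Iic (0 : ι → ℝ))) {t | ∃ x ∈ K, h x ≤ t} := by
    rw [hint, Set.disjoint_left]
    rintro t ht ⟨x, hx, hxt⟩
    exact hneg ⟨x, hx, fun l => (hxt l).trans_lt (ht l)⟩
  obtain ⟨x₀, hx₀⟩ := hne
  obtain ⟨φ, u, hφ, hle, hge⟩ := geometric_hahn_banach_of_nonempty_interior (convex_Iic _)
    (convex_setOf_exists_le hh) hdisj (hint ▸ ⟨-1, fun _ => by simp⟩) ⟨h x₀, x₀, hx₀, le_rfl⟩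
  have hφ_eq : ∀ t, φ t = ∑ l, φ (Pi.single l 1) * t l := fun t => by
    conv_lhs => rw [← Finset.univ_sum_single t, map_sum]
    refine Finset.sum_congr rfl fun l _ => ?_
    rw [mul_comm, ← smul_eq_mul, ← map_smul, ← Pi.single_smul, smul_eq_mul, mul_one]
  refine ⟨fun l => φ (Pi.single l 1), fun l => ?_, fun hzero => hφ ?_, fun x hx => ?_⟩
  · have hray : φ (-Pi.single l 1) ≤ 0 := nonpos_of_forall_mul_le (u := u) fun t ht => by
      rw [← smul_eq_mul, ← map_smul]
      refine hle _ (Set.mem_Iic.2 (smul_nonpos_of_nonneg_of_nonpos ht ?_))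
      exact neg_nonpos.2 (Pi.single_nonneg.2 zero_le_one)
    simpa using hray
  · ext t
    simp [hφ_eq t, fun l => congrFun hzero l]
  · calc (0 : ℝ) = φ 0 := (map_zero φ).symm
      _ ≤ u := hle 0 (Set.mem_Iic.2 le_rfl)
      _ ≤ φ (h x) := hge _ ⟨x, hx, le_rfl⟩
      _ = ∑ l, φ (Pi.single l 1) * h x l := hφ_eq _

/-- Lagrangian duality for a concave program under Slater's condition. -/
theorem exists_multipliers_of_slater {f : E → ℝ} {g : E → κ → ℝ} {m : ℝ} (hf : ConcaveOn ℝ K f)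
    (hg : ConvexOn ℝ K g) {x₀ : E} (hx₀ : x₀ ∈ K) (hslater : ∀ l, g x₀ l < 0)
    (hm : ∀ x ∈ K, g x ≤ 0 → f x ≤ m) :
    ∃ y : κ → ℝ, 0 ≤ y ∧ ∀ x ∈ K, f x ≤ m + ∑ l, y l * g x l := by
  let h : E → Option κ → ℝ := fun x o => o.elim (m - f x) (g x)
  have hh : ConvexOn ℝ K h := by
    refine ⟨hg.1, fun x hx x' hx' a b ha hb hab => ?_⟩
    rintro (_ | l)
    · have hconc := hf.2 hx hx' ha hb hab
      simp only [h, Option.elim_none, Pi.add_apply, Pi.smul_apply, smul_eq_mul] at hconc ⊢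
      linear_combination hconc - m * hab
    · exact hg.2 hx hx' ha hb hab l
  obtain ⟨w, hw, hw0, hsum⟩ := exists_weights_of_not_exists_forall_neg hh ⟨x₀, hx₀⟩ fun
    ⟨x, hx, hneg⟩ => (sub_neg.1 (hneg none)).not_ge (hm x hx fun l => (hneg (some l)).le)
  simp only [h, Fintype.sum_option, Option.elim_none, Option.elim_some] at hsum
  have hw_none : 0 < w none := by
    refine (hw none).lt_of_ne fun hzero => hw0 ?_
    have hterm : ∀ l ∈ Finset.univ, w (some l) * g x₀ l ≤ 0 := fun l _ =>
      mul_nonpos_of_nonneg_of_nonpos (hw _) (hslater l).le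
    have hvanish := (Finset.sum_eq_zero_iff_of_nonpos hterm).1
      ((Finset.sum_nonpos hterm).antisymm (by simpa [← hzero] using hsum x₀ hx₀))
    funext o
    rcases o with _ | l
    · exact hzero.symm
    · exact (mul_eq_zero.1 (hvanish l (Finset.mem_univ l))).resolve_right (hslater l).ne
  refine ⟨fun l => w (some l) / w none, fun l => div_nonneg (hw _) hw_none.le, fun x hx => ?_⟩
  have hscale : w none * ∑ l, w (some l) / w none * g x l = ∑ l, w (some l) * g x l := by
    rw [Finset.mul_sum]
    exact Finset.sum_congr rfl fun l _ => by field_simp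
  refine le_of_mul_le_mul_left ?_ hw_none
  linear_combination hsum x hx - hscale

end ConvexDuality

section LinearPrograms

variable {N G : Type*} [Fintype G] {k : ℕ}

theorem price_nonneg {p : G → ℝ} (hp : ∀ j, 0 ≤ p j) (B : Bundle G k) : 0 ≤ price p B :=
  Finset.sum_nonneg fun j _ => mul_nonneg (Nat.cast_nonneg _) (hp j)

theorem price_add_le_price_add_const (p : G → ℝ) {t : ℝ} (ht : 0 ≤ t) (B : Bundle G k) :
    price p B + t ≤ price (fun j => p j + t) B := by
  have hsize : (1 : ℝ) ≤ ∑ j, (B.1 j : ℝ) := by exact_mod_cast B.2.1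
  simp only [price, mul_add, Finset.sum_add_distrib, ← Finset.sum_mul]
  linarith [le_mul_of_one_le_left ht hsize]

variable [Fintype N]

theorem value_add_smul (c x y : N → Bundle G k → ℝ) (a b : ℝ) :
    value c (a • x + b • y) = a * value c x + b * value c y := by
  simp [value, Finset.sum_add_distrib, mul_add, Finset.mul_sum, mul_left_comm]

theorem value_single [DecidableEq N] (c : N → Bundle G k → ℝ) (i : N) (B : Bundle G k) (t : ℝ) :
    value c (Pi.single i (Pi.single B t)) = c i B * t := by
  have hrow : ∀ i', ∑ B', c i' B' * (Pi.single i (Pi.single B t) : N → Bundle G k → ℝ) i' B' =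
      if i' = i then c i B * t else 0 := fun i' => by
    rcases eq_or_ne i' i with rfl | hne
    · simp [Pi.single_apply]
    · simp [hne]
  simp [value, hrow]

theorem usage_eq_value (x : N → Bundle G k → ℝ) (j : G) :
    usage x j = value (fun _ B => (B.1 j : ℝ)) x :=
  rfl

theorem value_add_price (α : N → ℝ) (p : G → ℝ) (x : N → Bundle G k → ℝ) :
    value (fun i B => α i + price p B) x =
      ∑ i, α i * ∑ B, x i B + ∑ j, p j * usage x j := by
  have husage : ∑ j, p j * usage x j = ∑ i, ∑ B, price p B * x i B := by
    simp only [usage, price, Finset.mul_sum, Finset.sum_mul]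
    rw [Finset.sum_comm]
    refine Finset.sum_congr rfl fun i _ => ?_
    rw [Finset.sum_comm]
    exact Finset.sum_congr rfl fun B _ => Finset.sum_congr rfl fun j _ => by ring
  simp only [value, add_mul, Finset.sum_add_distrib, husage, Finset.mul_sum]

theorem concaveOn_value (c : N → Bundle G k → ℝ) : ConcaveOn ℝ (Set.Ici 0) (value c) :=
  ⟨convex_Ici 0, fun x _ y _ a b _ _ _ => (value_add_smul c x y a b).ge⟩

theorem convexOn_constraints (σ : G → ℝ) :
    ConvexOn ℝ (Set.Ici 0) fun (x : N → Bundle G k → ℝ) =>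
      Sum.elim (fun i => ∑ B, x i B - 1) (fun j => usage x j - σ j) := by
  refine ⟨convex_Ici 0, fun x _ y _ a b _ _ hab => le_of_eq (funext ?_)⟩
  rintro (i | j)
  · simp only [Sum.elim_inl, Pi.add_apply, Pi.smul_apply, smul_eq_mul, Finset.sum_add_distrib,
      ← Finset.mul_sum]
    linear_combination hab
  · simp only [Sum.elim_inr, Pi.add_apply, Pi.smul_apply, smul_eq_mul, usage_eq_value,
      value_add_smul]
    linear_combination σ j * hab

/-- Strong duality. -/
theorem exists_dualFeasible_dualValue_le {v : N → Bundle G k → ℝ} {σ : G → ℝ}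
    {x : N → Bundle G k → ℝ} (hσ : ∀ j, 0 < σ j) (hx : IsPrimalOptimal v σ x) :
    ∃ α p, DualFeasible v α p ∧ dualValue σ α p ≤ value v x := by
  classical
  obtain ⟨y, hy, hy_le⟩ := exists_multipliers_of_slater (concaveOn_value v)
    (convexOn_constraints σ) (Set.mem_Ici.2 le_rfl)
    (by rintro (i | j) <;> simp [usage, hσ]) (m := value v x) (fun z hz hle =>
      hx.2 z ⟨hz, fun i => sub_nonpos.1 (hle (.inl i)), fun j => sub_nonpos.1 (hle (.inr j))⟩)
  set α : N → ℝ := fun i => y (.inl i)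
  set p : G → ℝ := fun j => y (.inr j)
  have hlagrange : ∀ z, 0 ≤ z →
      value v z ≤ value v x - dualValue σ α p + value (fun i B => α i + price p B) z := by
    intro z hz
    refine (hy_le z hz).trans_eq ?_
    simp only [Fintype.sum_sum_type, Sum.elim_inl, Sum.elim_inr, mul_sub, mul_one,
      Finset.sum_sub_distrib, value_add_price, dualValue, α, p, mul_comm (σ _)]
    ring
  refine ⟨α, p, ⟨fun i => hy _, fun j => hy _, fun i B => ?_⟩, ?_⟩
  · refine sub_nonpos.1 (nonpos_of_forall_mul_le (u := value v x - dualValue σ α p)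
      fun t ht => ?_)
    have hz := hlagrange (Pi.single i (Pi.single B t))
      (Pi.single_nonneg.2 (Pi.single_nonneg.2 ht))
    simp only [value_single] at hz
    linear_combination hz
  · have hzero := hlagrange 0 le_rfl
    simp only [value, Pi.zero_apply, mul_zero, Finset.sum_const_zero] at hzero ⊢
    linear_combination hzero

theorem sum_slack_mul_le_dualityGap {v : N → Bundle G k → ℝ} {σ : G → ℝ} {x : N → Bundle G k → ℝ}
    {α : N → ℝ} {p : G → ℝ} (hx : Feasible σ x) (hp : DualFeasible v α p) :
    ∑ i, ∑ B, (α i + price p B - v i B) * x i B ≤ dualValue σ α p - value v x := by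
  have hdemand : ∑ i, α i * ∑ B, x i B ≤ ∑ i, α i :=
    Finset.sum_le_sum fun i _ => mul_le_of_le_one_right (hp.1 i) (hx.2.1 i)
  have hsupply : ∑ j, p j * usage x j ≤ ∑ j, σ j * p j :=
    Finset.sum_le_sum fun j _ =>
      (mul_le_mul_of_nonneg_left (hx.2.2 j) (hp.2.1 j)).trans_eq (mul_comm _ _)
  have hsplit := value_add_price α p x
  simp only [value, dualValue, sub_mul, Finset.sum_sub_distrib] at hsplit ⊢
  linarith

/-- Complementary slackness. -/
theorem IsDualOptimal.add_price_eq {v : N → Bundle G k → ℝ} {σ : G → ℝ}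
    {x : N → Bundle G k → ℝ} {α : N → ℝ} {p : G → ℝ} (hp : IsDualOptimal v σ α p)
    (hσ : ∀ j, 0 < σ j) (hx : IsPrimalOptimal v σ x) {i : N} {B : Bundle G k}
    (hxB : x i B ≠ 0) : α i + price p B = v i B := by
  obtain ⟨α', p', hfeas, hval⟩ := exists_dualFeasible_dualValue_le hσ hx
  have hterm : ∀ i B, 0 ≤ (α i + price p B - v i B) * x i B := fun i B =>
    mul_nonneg (by linarith [hp.1.2.2 i B]) (hx.1.1 i B)
  have hgap : ∑ i, ∑ B, (α i + price p B - v i B) * x i B = 0 :=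
    ((sum_slack_mul_le_dualityGap hx.1 hp.1).trans
      (sub_nonpos.2 ((hp.2 α' p' hfeas).trans hval))).antisymm
      (Finset.sum_nonneg fun i _ => Finset.sum_nonneg fun B _ => hterm i B)
  have hrow := (Finset.sum_eq_zero_iff_of_nonneg fun i _ =>
    Finset.sum_nonneg fun B _ => hterm i B).1 hgap i (Finset.mem_univ i)
  have hentry := (Finset.sum_eq_zero_iff_of_nonneg fun B _ => hterm i B).1 hrow B
    (Finset.mem_univ B)
  exact sub_eq_zero.1 ((mul_eq_zero.1 hentry).resolve_right hxB)

theorem IsDualOptimal.le_price_of_sum_lt_card {v : N → Bundle G k → ℝ} {σ : G → ℝ}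
    {α : N → ℝ} {p : G → ℝ} (hp : IsDualOptimal v σ α p) {T : Finset N}
    (hT : ∑ j, σ j < T.card) {B : Bundle G k} {a : ℝ} (ha : ∀ i ∈ T, a ≤ v i B) :
    a ≤ price p B := by
  classical
  by_contra! hlt
  -- Raise all prices by the deficit `t` and lower `α` by `t` on `T`: since every bundle is nonempty
  -- this stays dual feasible, and the dual objective changes by `t (∑ σ - #T) < 0`.
  set t := a - price p B
  have ht0 : 0 < t := sub_pos.2 hlt
  have hfeas : DualFeasible v (fun i => if i ∈ T then α i - t else α i) (fun j => p j + t) := by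
    refine ⟨fun i => ?_, fun j => add_nonneg (hp.1.2.1 j) ht0.le, fun i B' => ?_⟩
    · by_cases hi : i ∈ T
      · simp only [hi, if_true]
        linarith [ha i hi, hp.1.2.2 i B]
      · simpa only [hi, if_false] using hp.1.1 i
    · have hraise := price_add_le_price_add_const p ht0.le B'
      by_cases hi : i ∈ T <;> simp only [hi, if_true, if_false] <;> linarith [hp.1.2.2 i B']
  have hchange : dualValue σ (fun i => if i ∈ T then α i - t else α i) (fun j => p j + t) =
      dualValue σ α p + t * (∑ j, σ j - T.card) := by
    have hα : ∀ i, (if i ∈ T then α i - t else α i) = α i - if i ∈ T then t else 0 := fun i => by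
      split_ifs <;> simp
    simp only [dualValue, hα, mul_add, Finset.sum_add_distrib, Finset.sum_sub_distrib,
      Finset.sum_ite_mem, Finset.univ_inter, Finset.sum_const, nsmul_eq_mul, ← Finset.sum_mul]
    ring
  have hopt := hp.2 _ _ hfeas
  rw [hchange] at hopt
  linarith [mul_neg_of_pos_of_neg ht0 (sub_neg.2 hT)]

end LinearPrograms

section LotteryConstruction

variable {N G : Type*} [Fintype G] {k : ℕ}

/-- The nonnegative points that satisfy (Demand) and vanish wherever `x` does: a face of the
polytope cut out by (Demand), which rounding never leaves. -/
def demandFace (x : N → Bundle G k → ℝ) : Set (N → Bundle G k → ℝ) :=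
  {z | (∀ i B, 0 ≤ z i B) ∧ (∀ i, ∑ B, z i B ≤ 1) ∧ ∀ i B, x i B = 0 → z i B = 0}

theorem convex_demandFace (x : N → Bundle G k → ℝ) : Convex ℝ (demandFace x) := by
  rintro z ⟨h0, h1, h2⟩ z' ⟨h0', h1', h2'⟩ s t hs ht hst
  refine ⟨fun i B => ?_, fun i => ?_, fun i B h => ?_⟩
  · exact add_nonneg (mul_nonneg hs (h0 i B)) (mul_nonneg ht (h0' i B))
  · simp only [Pi.add_apply, Pi.smul_apply, Finset.sum_add_distrib, ← Finset.smul_sum]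
    exact convex_Iic (1 : ℝ) (h1 i) (h1' i) hs ht hst
  · simp [h2 i B h, h2' i B h]

variable [Fintype N]

theorem IsIR.mem_demandFace {σ : G → ℝ} {x z c z' : N → Bundle G k → ℝ} (h : IsIR σ z c z')
    (hz : z ∈ demandFace x) : z' ∈ demandFace x := by
  obtain ⟨A, hA, -⟩ := h
  suffices ∀ st, Relation.ReflTransGen (IRStep σ c {i | ∑ B, z i B = 1}) (z, Set.univ) st →
      st.1 ∈ demandFace x from this _ hA
  intro st hst
  induction hst with
  | refl => exact hz
  | tail _ hstep ih =>
    obtain ⟨h0, hfix, heq, hle, -⟩ := hstep.2.1.1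
    refine ⟨h0, fun i => ?_, fun i B hB => ?_⟩
    · by_cases hi : i ∈ {i | ∑ B, z i B = 1}
      · exact (heq i hi).le
      · exact hle i hi
    · have hzero := ih.2.2 i B hB
      rw [hfix i B fun hfrac => hfrac.1.ne' hzero, hzero]

theorem IsLotterySet.subset_demandFace {v x : N → Bundle G k → ℝ} {σ : G → ℝ} {δε tol : ℝ}
    {F : Set (N → Bundle G k → ℝ)} (h : IsLotterySet v σ δε tol x F) (hx : x ∈ demandFace x) :
    F ⊆ demandFace x := by
  obtain ⟨x', x'', hx', hx'', hF⟩ := h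
  induction hF with
  | refl =>
    rintro z (rfl | rfl)
    · exact hx'.mem_demandFace hx
    · exact hx''.mem_demandFace hx
  | tail _ hstep ih =>
    obtain ⟨y, F', δ, z, zbar, hy, -, hF', -, -, hz, hfeas, hIR, rfl⟩ := hstep
    have hyx : y ∈ demandFace x := convexHull_min ih (convex_demandFace x) hy.1
    refine Set.insert_subset (hIR.mem_demandFace ⟨hfeas.1, hfeas.2.1, fun i B hB => ?_⟩)
      (hF'.prop.1.trans ih)
    simp [hz, hB, hyx.2.2 i B hB]

theorem IsLottery.mean_mem_demandFace [DecidableEq N] {v x : N → Bundle G k → ℝ} {σ σ' : G → ℝ}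
    {δε tol : ℝ} {lam : (N → Bundle G k → Bool) → ℝ} (h : IsLottery v σ δε tol x lam)
    (hx : Feasible σ' x) : ∑ a, lam a • ofBool a ∈ demandFace x := by
  obtain ⟨F, y, hF, hy, -, -, -, -, rfl⟩ := h
  exact convexHull_min (hF.subset_demandFace ⟨hx.1, hx.2.1, fun _ _ => id⟩)
    (convex_demandFace x) hy.1

end LotteryConstruction

section Draws

variable {Θ G : Type*} [Fintype G] {P : Auction Θ G}

/-- The draws all of whose weights and supply reductions lie in the intervals from which they are
drawn. -/
def drawRange (P : Auction Θ G) : Set (Draw Θ (G := G) P.k) :=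
  {d | (∀ q, d.1 q ∈ Set.Icc (1 - P.δw) (1 + P.δw)) ∧ ∀ j, d.2 j ∈ Set.Icc P.δε (2 * P.δε)}

instance isZeroOrProbabilityMeasure_unif (a b : ℝ) : IsZeroOrProbabilityMeasure (unif a b) := by
  unfold unif
  infer_instance

theorem isProbabilityMeasure_unif {a b : ℝ} (h : a < b) : IsProbabilityMeasure (unif a b) :=
  ProbabilityTheory.cond_isProbabilityMeasure_of_finite (by simp [h]) (by simp)

theorem ae_mem_pi_unif {ι : Type*} [Fintype ι] (a b : ℝ) :
    ∀ᵐ x ∂Measure.pi fun _ : ι => unif a b, ∀ l, x l ∈ Set.Icc a b :=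
  ae_all_iff.2 fun _ => Measure.tendsto_eval_ae_ae.eventually
    (ProbabilityTheory.ae_cond_mem measurableSet_Icc)

theorem reducedSupply_pos {d : Draw Θ (G := G) P.k} (hd : d ∈ drawRange P)
    (hs : ∀ j, 2 * P.δε < (P.s j : ℝ)) (j : G) : 0 < reducedSupply P d j :=
  sub_pos.2 ((hd.2 j).2.trans_lt (hs j))

theorem sum_reducedSupply_le {d : Draw Θ (G := G) P.k} (hd : d ∈ drawRange P) (he0 : 0 ≤ P.δε) :
    ∑ j, reducedSupply P d j ≤ ∑ j, (P.s j : ℝ) :=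
  Finset.sum_le_sum fun j _ => sub_le_self _ (he0.trans (hd.2 j).1)

variable [Fintype Θ]

theorem isProbabilityMeasure_drawLaw (hw0 : 0 < P.δw) (he0 : 0 < P.δε) :
    IsProbabilityMeasure (drawLaw P) := by
  have := isProbabilityMeasure_unif (show 1 - P.δw < 1 + P.δw by linarith)
  have := isProbabilityMeasure_unif (show P.δε < 2 * P.δε by linarith)
  unfold drawLaw
  infer_instance

theorem ae_mem_drawRange (P : Auction Θ G) : ∀ᵐ d ∂drawLaw P, d ∈ drawRange P :=
  (Measure.quasiMeasurePreserving_fst.ae (ae_mem_pi_unif _ _)).and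
    (Measure.quasiMeasurePreserving_snd.ae (ae_mem_pi_unif _ _))

end Draws

section Payoffs

variable {Θ G : Type*} [Fintype G] {P : Auction Θ G} {n : ℕ}

theorem payoff_eq_sum (P : Auction Θ G) (θ : Θ) (i : Fin n) (o : Outcome G P.k n) :
    payoff P θ i o =
      ∑ B, (∑ a, o.lottery a • ofBool a) i B • (P.u θ B - price o.prices B) := by
  simp only [payoff, Finset.sum_apply, Pi.smul_apply, smul_eq_mul, Finset.mul_sum, Finset.sum_mul]
  rw [Finset.sum_comm]
  exact Finset.sum_congr rfl fun B _ => Finset.sum_congr rfl fun a _ => by ring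

/-- The payoff is an average of `0` and the utilities of bundles in the support of the linear
programming solution, which by complementary slackness cost at most their weighted value. -/
theorem IsPOPTOutcome.payoff_mem {β : Fin n → Θ} {d : Draw Θ (G := G) P.k}
    {o : Outcome G P.k n} (ho : IsPOPTOutcome P β d o) (hσ : ∀ j, 0 < reducedSupply P d j)
    (θ : Θ) (i : Fin n) {K : Set ℝ} (hK : Convex ℝ K) (hzero : 0 ∈ K)
    (hmem : ∀ B, price o.prices B ∈ Set.Icc 0 (weighted P β d i B) →
      P.u θ B - price o.prices B ∈ K) : payoff P θ i o ∈ K := by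
  obtain ⟨⟨x, hx, hlottery⟩, α, hp⟩ := ho
  obtain ⟨hmean0, hmean1, hsupport⟩ := hlottery.mean_mem_demandFace hx.1
  rw [payoff_eq_sum]
  refine sum_smul_mem_of_sum_le_one hK hzero (hmean0 i) (hmean1 i) fun B hB => hmem B ?_
  have hslack := hp.add_price_eq hσ hx (mt (hsupport i B) hB)
  exact ⟨price_nonneg hp.1.2.1 B, by linarith [hp.1.1 i]⟩

theorem IsPOPTOutcome.neg_le_payoff {β : Fin n → Θ} {d : Draw Θ (G := G) P.k}
    {o : Outcome G P.k n} (ho : IsPOPTOutcome P β d o) (hd : d ∈ drawRange P)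
    (hw1 : P.δw < 1) (hs : ∀ j, 2 * P.δε < (P.s j : ℝ)) {i : Fin n} {C : ℝ} (hC : 0 ≤ C)
    (hu : ∀ B, P.δw * P.u (β i) B ≤ C) : -C ≤ payoff P (β i) i o := by
  refine ho.payoff_mem (reducedSupply_pos hd hs) (β i) i (convex_Ici (-C))
    (Set.mem_Ici.2 (neg_nonpos.2 hC)) fun B ⟨hprice0, hprice⟩ => Set.mem_Ici.2 ?_
  obtain ⟨hlow, hhigh⟩ := hd.1 (β i, B)
  have hu_nonneg : 0 ≤ P.u (β i) B :=
    nonneg_of_mul_nonneg_right (hprice0.trans hprice) (by linarith)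
  have hweight : weighted P β d i B ≤ (1 + P.δw) * P.u (β i) B :=
    mul_le_mul_of_nonneg_right hhigh hu_nonneg
  linarith [hu B]

theorem IsPOPTOutcome.payoff_le [DecidableEq Θ] {β : Fin n → Θ} {d : Draw Θ (G := G) P.k}
    {o : Outcome G P.k n} (ho : IsPOPTOutcome P β d o) (hd : d ∈ drawRange P)
    (he0 : 0 ≤ P.δε) (hs : ∀ j, 2 * P.δε < (P.s j : ℝ)) {θ : Θ}
    (hcard : ∑ j, P.s j < Fintype.card {l // β l = θ}) (i : Fin n) {C : ℝ} (hC : 0 ≤ C)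
    (hu : ∀ B, P.δw * P.u θ B ≤ C) : payoff P θ i o ≤ C := by
  refine ho.payoff_mem (reducedSupply_pos hd hs) θ i (convex_Iic C) hC
    fun B ⟨hprice0, _⟩ => Set.mem_Iic.2 ?_
  obtain ⟨-, α, hp⟩ := ho
  have hprice : d.1 (θ, B) * P.u θ B ≤ price o.prices B := by
    refine hp.le_price_of_sum_lt_card (T := {l | β l = θ})
      ((sum_reducedSupply_le hd he0).trans_lt ?_) fun l hl => ?_
    · rw [← Fintype.card_subtype]
      exact_mod_cast hcard
    · rw [← (Finset.mem_filter.1 hl).2, weighted]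
  rcases le_total (P.u θ B) 0 with hneg | hnonneg
  · linarith
  · have hweight := mul_le_mul_of_nonneg_right (hd.1 (θ, B)).1 hnonneg
    linarith [hu B]

theorem IsPOPTOutcome.abs_payoff_le [Fintype Θ] {β : Fin n → Θ} {d : Draw Θ (G := G) P.k}
    {o : Outcome G P.k n} (ho : IsPOPTOutcome P β d o) (hd : d ∈ drawRange P)
    (hs : ∀ j, 2 * P.δε < (P.s j : ℝ)) (θ : Θ) (i : Fin n) :
    |payoff P θ i o| ≤ (2 + |P.δw|) * ‖P.u‖ := by
  have hu : ∀ θ B, |P.u θ B| ≤ ‖P.u‖ := fun θ B =>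
    (norm_le_pi_norm (P.u θ) B).trans (norm_le_pi_norm P.u θ)
  refine abs_le.2 (ho.payoff_mem (reducedSupply_pos hd hs) θ i (convex_Icc _ _)
    (abs_le.1 (by rw [abs_zero]; positivity)) fun B ⟨hprice0, hprice⟩ => abs_le.1 ?_)
  have hw : |d.1 (β i, B)| ≤ 1 + |P.δw| := by
    obtain ⟨hlow, hhigh⟩ := hd.1 (β i, B)
    exact abs_le.2 ⟨by linarith [le_abs_self P.δw], by linarith [le_abs_self P.δw]⟩
  calc |P.u θ B - price o.prices B| ≤ |P.u θ B| + price o.prices B := by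
        simpa only [abs_of_nonneg hprice0] using abs_sub (P.u θ B) (price o.prices B)
    _ ≤ |P.u θ B| + |d.1 (β i, B)| * |P.u (β i) B| := by
        rw [← abs_mul]
        exact add_le_add_right (hprice.trans (le_abs_self _)) _
    _ ≤ ‖P.u‖ + (1 + |P.δw|) * ‖P.u‖ :=
        add_le_add (hu θ B) (mul_le_mul hw (hu (β i) B) (abs_nonneg _) (by positivity))
    _ = (2 + |P.δw|) * ‖P.u‖ := by ring

theorem IsPOPT.integrable_payoff [Fintype Θ] {M : Mechanism Θ G P.k} (hM : IsPOPT P M)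
    (hs : ∀ j, 2 * P.δε < (P.s j : ℝ)) (β : Fin n → Θ) (θ : Θ) (i : Fin n) :
    Integrable (fun d => payoff P θ i (M n β d)) (drawLaw P) := by
  obtain ⟨houtcome, hprices, hlottery⟩ := hM n β
  have : IsFiniteMeasure (drawLaw P) := by
    unfold drawLaw
    infer_instance
  refine Integrable.of_bound (C := (2 + |P.δw|) * ‖P.u‖)
    (AEMeasurable.aestronglyMeasurable ?_) ?_
  · unfold payoff price
    fun_prop
  · filter_upwards [houtcome, ae_mem_drawRange P] with d ho hd using ho.abs_payoff_le hd hs θ i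

end Payoffs

theorem card_subtype_eq_le_card_update_add_one {ι Θ : Type*} [Fintype ι] [DecidableEq ι]
    [DecidableEq Θ] (β : ι → Θ) (i : ι) (ζ θ : Θ) :
    Fintype.card {l // β l = θ} ≤ Fintype.card {l // Function.update β i ζ l = θ} + 1 := by
  simp only [Fintype.card_subtype]
  refine (Finset.card_le_card fun l hl => ?_).trans (Finset.card_insert_le i _)
  rcases eq_or_ne l i with rfl | hne
  · exact Finset.mem_insert_self l _
  · simpa [hne] using hl

end POPT

open POPT in
theorem theorem3p2_general {Θ G : Type*} [Fintype Θ] [DecidableEq Θ] [Fintype G]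
    (P : Auction Θ G) (hw0 : 0 < P.δw) (hw1 : P.δw < 1) (he0 : 0 < P.δε)
    (hs : ∀ j, 2 * P.δε < (P.s j : ℝ)) {εu : ℝ} (hu0 : 0 ≤ εu)
    {M : Mechanism Θ G P.k} (hM : IsPOPT P M) {n : ℕ} (β β' : Fin n → Θ) (i : Fin n)
    (hu : ∀ B, 2 * P.δw * P.u (β i) B ≤ εu)
    (hcard : ∑ j, P.s j < Fintype.card {l // β' l = β i}) :
    Integrable (fun d => payoff P (β i) i (M n β d)) (drawLaw P) ∧
      Integrable (fun d => payoff P (β i) i (M n β' d)) (drawLaw P) ∧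
      ∫ d, payoff P (β i) i (M n β' d) ∂drawLaw P - εu
        ≤ ∫ d, payoff P (β i) i (M n β d) ∂drawLaw P := by
  have := isProbabilityMeasure_drawLaw hw0 he0
  have hint := hM.integrable_payoff hs β (β i) i
  have hint' := hM.integrable_payoff hs β' (β i) i
  have hhalf : 0 ≤ εu / 2 := by positivity
  have hu' : ∀ B, P.δw * P.u (β i) B ≤ εu / 2 := fun B => by linarith [hu B]
  have hpointwise : ∀ᵐ d ∂drawLaw P,
      payoff P (β i) i (M n β' d) ≤ payoff P (β i) i (M n β d) + εu := by
    filter_upwards [(hM n β).1, (hM n β').1, ae_mem_drawRange P] with d ho ho' hd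
    linarith [ho.neg_le_payoff hd hw1 hs hhalf hu',
      ho'.payoff_le hd he0.le hs hcard i hhalf hu']
  refine ⟨hint, hint', sub_le_iff_le_add.2 ?_⟩
  calc ∫ d, payoff P (β i) i (M n β' d) ∂drawLaw P
      ≤ ∫ d, (payoff P (β i) i (M n β d) + εu) ∂drawLaw P :=
        integral_mono_ae hint' (hint.add (integrable_const εu)) hpointwise
    _ = ∫ d, payoff P (β i) i (M n β d) ∂drawLaw P + εu := by
        rw [integral_add hint (integrable_const εu), integral_const, probReal_univ, one_smul]

theorem theorem3p2 {Θ G : Type*} [Fintype Θ] [DecidableEq Θ] [Fintype G]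
    (P : POPT.Auction Θ G)
    (hw0 : 0 < P.δw) (hw1 : P.δw < 1)
    (he0 : 0 < P.δε) (hs : ∀ j, 2 * P.δε < (P.s j : ℝ))
    (ht : 0 < P.tol)
    (εu : ℝ) (hu0 : 0 < εu) (hu : ∀ θ B, 2 * P.δw * P.u θ B ≤ εu)
    (M : POPT.Mechanism Θ G P.k) (hM : POPT.IsPOPT P M) :
    POPT.AsymptoticallyStrategyProof P M εu := by
  intro ε₀ hε₀
  refine ⟨∑ j, P.s j + 1, fun n β hβ i ζ => ?_⟩
  have hcard := (hβ (β i)).trans_le (POPT.card_subtype_eq_le_card_update_add_one β i ζ (β i))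
  obtain ⟨hint, hint', hle⟩ := theorem3p2_general P hw0 hw1 he0 hs hu0.le hM β _ i (hu (β i))
    (Nat.lt_of_add_lt_add_right hcard)
  exact ⟨hint, hint', by linarith⟩
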